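/- Let $V=\begin{pmatrix}0&1\\0&0\end{pmatrix}$, let $\tau$ be the product of the normalized traces on the algebraic infinite tensor product $\bigotimes_{n\ge1}M_2(\mathbb C)$ (all but finitely many tensor factors equal to $1$), and let $\mathcal H=L^2(\mathcal R,\tau)$ be its completion with respect to $\|x\|_2=\tau(x^*x)^{1/2}$, on which the algebra acts by left multiplication; this is the standard Hilbert space of the hyperfinite $\mathrm{II}_1$ factor $\mathcal R$. Let $0<\alpha<1$ and let $A\in\mathcal B(\mathcal H)$ be the norm-convergent sum $$A=\sum_{n=1}^{\infty}\alpha^nV_n,\qquad V_n=I^{\otimes(n-1)}\otimes V .$$ Let $r>0$ and let $\{\gamma_n\}_{n=1}^{\infty}$ be any sequence of positive real numbers. Put $$\mathcal E_r(A)=\Bigl\{\xi\in\mathcal H:\ \limsup_{n\to\infty}\gamma_n\,\|A^n\xi\|_2^{1/n}\le r\Bigr\},\qquad \mathcal H_r(A)=\overline{\mathcal E_r(A)}$$ (norm closure). Then either $\mathcal H_r(A)=\mathcal H$ or $\mathcal H_r(A)=\{0\}$. -/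

import Mathlib

open Filter

noncomputable section

namespace HyperfiniteFactor

/-- `Mat n` is the `n`-fold tensor product `M₂(ℂ) ⊗ ⋯ ⊗ M₂(ℂ)`: the complex matrices whose rows
and columns are indexed by `{0,1}ⁿ`. The entry of `x₀ ⊗ ⋯ ⊗ xₙ₋₁` at `(s, t)` is
`∏ i, xᵢ (s i) (t i)`, and `star` is the conjugate transpose. -/
abbrev Mat (n : ℕ) : Type := Matrix (Fin n → Fin 2) (Fin n → Fin 2) ℂ

/-- Underlying function of the embedding `x ↦ x ⊗ 1 ⊗ ⋯ ⊗ 1` of `Mat n` into `Mat m`, `n ≤ m`. -/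
def embedFun {n m : ℕ} (h : n ≤ m) (x : Mat n) : Mat m := Matrix.of fun s t =>
  if ∀ i : Fin m, n ≤ (i : ℕ) → s i = t i then
    x (fun i => s (Fin.castLE h i)) (fun i => t (Fin.castLE h i)) else 0

theorem embedFun_apply {n m : ℕ} (h : n ≤ m) (x : Mat n) (s t : Fin m → Fin 2) :
    embedFun h x s t = if ∀ i : Fin m, n ≤ (i : ℕ) → s i = t i then
      x (fun i => s (Fin.castLE h i)) (fun i => t (Fin.castLE h i)) else 0 := rfl

theorem embedFun_one {n m : ℕ} (h : n ≤ m) : embedFun h (1 : Mat n) = 1 := by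
  ext s t
  by_cases hst : s = t
  · subst hst; simp [embedFun_apply]
  · rw [Matrix.one_apply_ne hst]
    simp only [embedFun_apply]
    split_ifs with h1
    · rw [Matrix.one_apply_ne]
      intro h2
      apply hst
      funext i
      by_cases hi : (i : ℕ) < n
      · exact congrFun h2 ⟨i, hi⟩
      · exact h1 i (not_lt.mp hi)
    · rfl

theorem embedFun_mul {n m : ℕ} (h : n ≤ m) (x y : Mat n) :
    embedFun h (x * y) = embedFun h x * embedFun h y := by
  ext s t
  rw [Matrix.mul_apply]
  let e : (Fin n → Fin 2) → (Fin m → Fin 2) := fun p i =>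
    if hi : (i : ℕ) < n then p ⟨i, hi⟩ else s i
  have e1 : ∀ p (i : Fin n), e p (Fin.castLE h i) = p i := fun p i => by simp [e]
  have e2 : ∀ p (i : Fin m), n ≤ (i : ℕ) → e p i = s i := fun p i hi => by
    simp [e, not_lt.mpr hi]
  rw [← Finset.sum_of_injOn e (s := Finset.univ)
    (f := fun p => embedFun h x s (e p) * embedFun h y (e p) t)]
  · by_cases hst : ∀ i : Fin m, n ≤ (i : ℕ) → s i = t i
    · simp only [embedFun_apply]
      rw [if_pos hst, Matrix.mul_apply]
      refine Finset.sum_congr rfl fun p _ => ?_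
      rw [if_pos fun i hi => (e2 p i hi).symm, if_pos fun i hi => (e2 p i hi).trans (hst i hi)]
      simp only [e1]
    · have : ∀ p, ¬ ∀ i : Fin m, n ≤ (i : ℕ) → e p i = t i := fun p hp =>
        hst fun i hi => (e2 p i hi).symm.trans (hp i hi)
      simp only [embedFun_apply]
      rw [if_neg hst, Finset.sum_eq_zero]
      intro p _
      rw [if_neg (this p), mul_zero]
  · intro p _ q _ hpq
    funext i
    rw [← e1 p, ← e1 q, hpq]
  · intro p _; simp
  · intro r _ hr
    have : ¬ ∀ i : Fin m, n ≤ (i : ℕ) → s i = r i := by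
      intro h1
      apply hr
      refine ⟨fun i => r (Fin.castLE h i), by simp, ?_⟩
      funext i
      by_cases hi : (i : ℕ) < n
      · simp only [e, dif_pos hi]; rfl
      · exact (e2 (fun i => r (Fin.castLE h i)) i (not_lt.mp hi)).trans (h1 i (not_lt.mp hi))
    simp only [embedFun_apply]
    rw [if_neg this, zero_mul]
  · intro p _; rfl

/-- The unital `*`-homomorphism `x ↦ x ⊗ 1 ⊗ ⋯ ⊗ 1` from `Mat n` to `Mat m`, for `n ≤ m`. -/
def embed (n m : ℕ) (h : n ≤ m) : Mat n →⋆ₐ[ℂ] Mat m where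
  toFun := embedFun h
  map_one' := embedFun_one h
  map_mul' := embedFun_mul h
  map_zero' := by ext s t; simp [embedFun_apply]
  map_add' x y := by
    ext s t
    simp only [embedFun_apply, Matrix.add_apply]
    split_ifs <;> simp
  commutes' c := by
    rw [Algebra.algebraMap_eq_smul_one, Algebra.algebraMap_eq_smul_one, ← embedFun_one h]
    ext s t
    simp only [embedFun_apply, Matrix.smul_apply]
    split_ifs <;> simp
  map_star' x := by
    ext s t
    simp only [embedFun_apply, Matrix.star_apply]
    by_cases h1 : ∀ i : Fin m, n ≤ (i : ℕ) → s i = t i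
    · rw [if_pos h1, if_pos fun i hi => (h1 i hi).symm]
    · rw [if_neg h1, if_neg fun h2 => h1 fun i hi => (h2 i hi).symm, star_zero]

theorem embed_apply {n m : ℕ} (h : n ≤ m) (x : Mat n) (s t : Fin m → Fin 2) :
    embed n m h x s t = if ∀ i : Fin m, n ≤ (i : ℕ) → s i = t i then
      x (fun i => s (Fin.castLE h i)) (fun i => t (Fin.castLE h i)) else 0 := rfl

instance : DirectedSystem Mat (embed · · ·) where
  map_self n x := by
    ext s t
    rw [embed_apply, if_pos fun i hi => absurd i.2 (not_lt.mpr hi)]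
    rfl
  map_map := by
    intro k m n hnm hmk x
    ext s t
    simp only [embed_apply]
    by_cases h1 : ∀ i : Fin k, n ≤ (i : ℕ) → s i = t i
    · have h2 : ∀ i : Fin k, m ≤ (i : ℕ) → s i = t i := fun i hi => h1 i (hnm.trans hi)
      have h3 : ∀ i : Fin m, n ≤ (i : ℕ) → s (Fin.castLE hmk i) = t (Fin.castLE hmk i) :=
        fun i hi => h1 _ hi
      simp only [if_pos h1, if_pos h2, if_pos h3]
      rfl
    · rw [if_neg h1]
      split_ifs with h2 h3
      · refine absurd (fun i hi => ?_) h1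
        by_cases him : (i : ℕ) < m
        · exact h3 ⟨i, him⟩ hi
        · exact h2 i (not_lt.mp him)
      · rfl
      · rfl

/-- The algebraic infinite tensor product `⨂_{n ≥ 1} M₂(ℂ)` (all but finitely many tensor factors
equal to `1`), as the direct limit of the algebras `Mat n` along `x ↦ x ⊗ 1`. -/
def Alg : Type := DirectLimit Mat embed

instance : Ring Alg := inferInstanceAs (Ring (DirectLimit Mat embed))
instance : Algebra ℂ Alg := inferInstanceAs (Algebra ℂ (DirectLimit Mat embed))
instance : StarRing Alg := inferInstanceAs (StarRing (DirectLimit Mat embed))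
instance : StarModule ℂ Alg := inferInstanceAs (StarModule ℂ (DirectLimit Mat embed))

/-- The class in `Alg` of an element of a finite tensor product: `x ↦ x ⊗ 1 ⊗ 1 ⊗ ⋯`. -/
def ofMat (n : ℕ) (x : Mat n) : Alg := (⟦⟨n, x⟩⟧ : DirectLimit Mat embed)

theorem ofMat_embed {n m : ℕ} (h : n ≤ m) (x : Mat n) : ofMat m (embed n m h x) = ofMat n x :=
  DirectLimit.mk_apply (f := embed) n m x h

theorem ofMat_mul (n : ℕ) (x y : Mat n) : ofMat n (x * y) = ofMat n x * ofMat n y :=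
  (DirectLimit.mul_def (f := embed) n x y).symm

theorem ofMat_add (n : ℕ) (x y : Mat n) : ofMat n (x + y) = ofMat n x + ofMat n y :=
  (DirectLimit.add_def (f := embed) n x y).symm

theorem ofMat_smul (n : ℕ) (c : ℂ) (x : Mat n) : ofMat n (c • x) = c • ofMat n x :=
  (DirectLimit.smul_def (f := embed) n x c).symm

theorem ofMat_star (n : ℕ) (x : Mat n) : ofMat n (star x) = star (ofMat n x) :=
  (DirectLimit.star_def (f := embed) n x).symm

theorem ofMat_one (n : ℕ) : ofMat n 1 = 1 :=
  (DirectLimit.one_def (f := embed) n).symm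

theorem ofMat_zero (n : ℕ) : ofMat n 0 = 0 :=
  (DirectLimit.zero_def (f := embed) n).symm

theorem exists_ofMat (a : Alg) : ∃ n x, a = ofMat n x :=
  DirectLimit.exists_eq_mk embed a

theorem exists_ofMat₂ (a b : Alg) : ∃ n x y, a = ofMat n x ∧ b = ofMat n y :=
  DirectLimit.exists_eq_mk₂ embed a b

/-- The normalized trace of `Mat n`. -/
def normTrace (n : ℕ) (x : Mat n) : ℂ := (2 ^ n : ℂ)⁻¹ * Matrix.trace x

theorem normTrace_embed (n m : ℕ) (h : n ≤ m) (x : Mat n) :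
    normTrace n x = normTrace m (embed n m h x) := by
  obtain ⟨k, rfl⟩ := Nat.exists_eq_add_of_le h
  have : Matrix.trace (embed n (n + k) h x) = 2 ^ k * Matrix.trace x := by
    simp only [Matrix.trace, Matrix.diag_apply, embed_apply]
    rw [← (Fin.appendEquiv n k).sum_comp, Fintype.sum_prod_type, Finset.mul_sum]
    refine Finset.sum_congr rfl fun p _ => ?_
    simp
  rw [normTrace, normTrace, this, pow_add]
  field_simp

/-- The product trace `τ(x₁ ⊗ x₂ ⊗ ⋯) = ∏ₙ tr(xₙ)/2` on `Alg`: on `Mat n` it is the normalized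
trace. -/
def trace : Alg → ℂ := DirectLimit.lift embed normTrace normTrace_embed

theorem trace_ofMat (n : ℕ) (x : Mat n) : trace (ofMat n x) = normTrace n x := rfl

theorem trace_add (a b : Alg) : trace (a + b) = trace a + trace b := by
  obtain ⟨n, x, y, rfl, rfl⟩ := exists_ofMat₂ a b
  rw [← ofMat_add]
  simp only [trace_ofMat, normTrace, Matrix.trace_add, mul_add]

theorem trace_smul (c : ℂ) (a : Alg) : trace (c • a) = c * trace a := by
  obtain ⟨n, x, rfl⟩ := exists_ofMat a
  rw [← ofMat_smul]
  simp only [trace_ofMat, normTrace, Matrix.trace_smul, smul_eq_mul]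
  ring

theorem trace_star (a : Alg) : trace (star a) = star (trace a) := by
  obtain ⟨n, x, rfl⟩ := exists_ofMat a
  rw [← ofMat_star]
  simp only [trace_ofMat, normTrace, Matrix.star_eq_conjTranspose, Matrix.trace_conjTranspose]
  simp

theorem trace_star_mul_self (n : ℕ) (x : Mat n) :
    trace (star (ofMat n x) * ofMat n x) =
      (((2 ^ n : ℝ)⁻¹ * ∑ t, ∑ s, ‖x s t‖ ^ 2 : ℝ) : ℂ) := by
  rw [← ofMat_star, ← ofMat_mul, trace_ofMat, normTrace]
  simp only [Matrix.trace, Matrix.diag_apply, Matrix.mul_apply, Matrix.star_apply]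
  push_cast
  congr 1
  refine Finset.sum_congr rfl fun t _ => Finset.sum_congr rfl fun s _ => ?_
  exact Complex.conj_mul' _

/-- The inner product `⟨a, b⟩ = τ(a* b)` on `Alg`. -/
abbrev innerCore : InnerProductSpace.Core ℂ Alg where
  inner a b := trace (star a * b)
  conj_inner_symm a b := by
    rw [starRingEnd_apply, ← trace_star, star_mul, star_star]
  re_inner_nonneg a := by
    obtain ⟨n, x, rfl⟩ := exists_ofMat a
    rw [trace_star_mul_self]
    simp only [RCLike.ofReal_eq_complex_ofReal.symm, RCLike.ofReal_re]
    positivity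
  add_left a b c := by rw [star_add, add_mul, trace_add]
  smul_left a b c := by
    rw [star_smul, smul_mul_assoc, trace_smul, starRingEnd_apply]
  definite a ha := by
    obtain ⟨n, x, rfl⟩ := exists_ofMat a
    change trace (star (ofMat n x) * ofMat n x) = 0 at ha
    rw [trace_star_mul_self, Complex.ofReal_eq_zero, mul_eq_zero,
      or_iff_right (by positivity), Finset.sum_eq_zero_iff_of_nonneg
        (fun t _ => by positivity)] at ha
    rw [← ofMat_zero n]
    congr 1
    ext s t
    have := (Finset.sum_eq_zero_iff_of_nonneg (fun s _ => by positivity)).mp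
      (ha t (Finset.mem_univ t)) s (Finset.mem_univ s)
    simpa using this

instance : NormedAddCommGroup Alg :=
  InnerProductSpace.Core.toNormedAddCommGroup (cd := innerCore)

instance : InnerProductSpace ℂ Alg := InnerProductSpace.ofCore innerCore.toCore

theorem inner_def (a b : Alg) : inner ℂ a b = trace (star a * b) := rfl

/-- The Hilbert space `ℋ = L²(ℛ, τ)` of the standard form of the hyperfinite II₁ factor `ℛ`: the
completion of `⨂ M₂(ℂ)` with respect to the norm `‖a‖₂ = τ(a* a)^{1/2}`. -/
abbrev L2 : Type := UniformSpace.Completion Alg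

open scoped Matrix.Norms.L2Operator MatrixOrder in
theorem exists_star_mul_self_add (a : Alg) :
    ∃ (c : ℝ) (b : Alg), star a * a + star b * b = (c : ℂ) • (1 : Alg) := by
  obtain ⟨n, x, rfl⟩ := exists_ofMat a
  have h1 : star x * x ≤ algebraMap ℝ (Mat n) ‖star x * x‖ :=
    (IsSelfAdjoint.star_mul_self x).le_algebraMap_norm_self
  obtain ⟨y, hy⟩ := CStarAlgebra.nonneg_iff_eq_star_mul_self.mp (sub_nonneg.mpr h1)
  refine ⟨‖star x * x‖, ofMat n y, ?_⟩
  rw [← ofMat_star, ← ofMat_star, ← ofMat_mul, ← ofMat_mul, ← ofMat_add, ← hy, ← ofMat_one n,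
    ← ofMat_smul, add_sub_cancel, Algebra.algebraMap_eq_smul_one]
  congr 1

theorem norm_mul_le_of_star_mul_self_add {a b : Alg} {c : ℝ}
    (h : star a * a + star b * b = (c : ℂ) • (1 : Alg)) (x : Alg) :
    ‖a * x‖ ≤ √c * ‖x‖ := by
  have key : inner ℂ (a * x) (a * x) + inner ℂ (b * x) (b * x) = (c : ℂ) * inner ℂ x x := by
    simp only [inner_def, star_mul, ← trace_add, ← trace_smul]
    congr 1
    calc star x * star a * (a * x) + star x * star b * (b * x)
        = star x * (star a * a + star b * b) * x := by noncomm_ring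
      _ = (c : ℂ) • (star x * x) := by
        rw [h, mul_smul_comm, mul_one, smul_mul_assoc]
  have key2 : ‖a * x‖ ^ 2 + ‖b * x‖ ^ 2 = c * ‖x‖ ^ 2 := by
    simp only [inner_self_eq_norm_sq_to_K] at key
    apply Complex.ofReal_injective
    push_cast
    exact key
  have h3 : ‖a * x‖ ^ 2 ≤ c * ‖x‖ ^ 2 := by nlinarith [sq_nonneg ‖b * x‖]
  calc ‖a * x‖ = √(‖a * x‖ ^ 2) := (Real.sqrt_sq (norm_nonneg _)).symm
    _ ≤ √(c * ‖x‖ ^ 2) := Real.sqrt_le_sqrt h3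
    _ = √c * ‖x‖ := by rw [Real.sqrt_mul' _ (sq_nonneg _), Real.sqrt_sq (norm_nonneg _)]

/-- Left multiplication by `a` as a `‖·‖₂`-bounded operator on `Alg`. -/
def leftMul (a : Alg) : Alg →L[ℂ] Alg :=
  (LinearMap.mulLeft ℂ a).mkContinuousOfExistsBound (by
    obtain ⟨c, b, h⟩ := exists_star_mul_self_add a
    exact ⟨√c, norm_mul_le_of_star_mul_self_add h⟩)

/-- The representation `π` of `⨂ M₂(ℂ)` on `ℋ = L²(ℛ, τ)` by left multiplication: the bounded
operator `π a` extends `x ↦ a x`. -/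
def leftRep (a : Alg) : L2 →L[ℂ] L2 := (leftMul a).completion

theorem leftRep_coe (a x : Alg) : leftRep a (x : L2) = ((a * x : Alg) : L2) :=
  ContinuousLinearMap.completion_apply_coe _ _

/-- The matrix `V = (0 1; 0 0)`. -/
def V : Matrix (Fin 2) (Fin 2) ℂ := !![0, 1; 0, 0]

/-- The elementary tensor `1 ⊗ ⋯ ⊗ 1 ⊗ x` in `Mat (n + 1)`, with `n` factors `1`. -/
def lastSite (n : ℕ) (x : Matrix (Fin 2) (Fin 2) ℂ) : Mat (n + 1) :=
  Matrix.of fun s t =>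
  if ∀ i : Fin n, s i.castSucc = t i.castSucc then x (s (Fin.last n)) (t (Fin.last n)) else 0

/-- `Vop n` is the operator `1^{⊗ n} ⊗ V` on `ℋ`. -/
def Vop (n : ℕ) : L2 →L[ℂ] L2 := leftRep (ofMat (n + 1) (lastSite n V))

theorem lastSite_apply (n : ℕ) (x : Matrix (Fin 2) (Fin 2) ℂ) (s t : Fin (n + 1) → Fin 2) :
    lastSite n x s t = if ∀ i : Fin n, s i.castSucc = t i.castSucc then
      x (s (Fin.last n)) (t (Fin.last n)) else 0 := rfl

theorem lastSite_star_mul_self_add (n : ℕ) :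
    star (lastSite n V) * lastSite n V + star (star (lastSite n V)) * star (lastSite n V) = 1 := by
  have key : ∀ y : Matrix (Fin 2) (Fin 2) ℂ,
      star (lastSite n y) * lastSite n y = lastSite n (star y * y) := by
    intro y
    ext s t
    rw [Matrix.mul_apply, ← (Fin.snocEquiv fun _ => Fin 2).sum_comp, Fintype.sum_prod_type]
    simp only [Matrix.star_apply, lastSite_apply, Fin.snocEquiv, Equiv.coe_fn_mk, Fin.snoc_castSucc,
      Fin.snoc_last]
    by_cases hst : ∀ i : Fin n, s i.castSucc = t i.castSucc
    · rw [if_pos hst, Matrix.mul_apply]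
      refine Finset.sum_congr rfl fun j _ => ?_
      rw [Finset.sum_eq_single fun i => s i.castSucc]
      · simp [hst, Matrix.star_apply]
      · intro p _ hp
        rw [if_neg fun h => hp (funext h), star_zero, zero_mul]
      · simp
    · rw [if_neg hst]
      refine Finset.sum_eq_zero fun j _ => Finset.sum_eq_zero fun p _ => ?_
      by_cases hp : ∀ i : Fin n, p i = s i.castSucc
      · have hq : ¬ ∀ i : Fin n, p i = t i.castSucc := fun h =>
          hst fun i => (hp i).symm.trans (h i)
        simp [hq]
      · simp [hp]
  have hs : star (lastSite n V) = lastSite n (star V) := by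
    ext s t
    simp only [Matrix.star_apply, lastSite_apply]
    by_cases hst : ∀ i : Fin n, s i.castSucc = t i.castSucc
    · rw [if_pos hst, if_pos fun i => (hst i).symm]
    · rw [if_neg hst, if_neg fun h => hst fun i => (h i).symm, star_zero]
  have hV : star V * V + V * star V = 1 := by
    ext i j
    rw [Matrix.add_apply, Matrix.mul_apply, Matrix.mul_apply]
    fin_cases i <;> fin_cases j <;> simp [V, Matrix.star_apply]
  rw [key, hs, key, star_star]
  have hadd : ∀ y z, lastSite n y + lastSite n z = lastSite n (y + z) := by
    intro y z
    ext s t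
    simp only [Matrix.add_apply, lastSite_apply]
    split_ifs <;> simp
  rw [hadd, hV]
  ext s t
  by_cases hst : s = t
  · subst hst; simp [lastSite_apply]
  · rw [Matrix.one_apply_ne hst]
    simp only [lastSite_apply]
    split_ifs with h1
    · rw [Matrix.one_apply_ne]
      intro h2
      exact hst (funext fun i => Fin.lastCases h2 h1 i)
    · rfl

theorem norm_Vop_le (n : ℕ) : ‖Vop n‖ ≤ 1 := by
  have h0 : star (ofMat (n + 1) (lastSite n V)) * ofMat (n + 1) (lastSite n V) +
      star (star (ofMat (n + 1) (lastSite n V))) * star (ofMat (n + 1) (lastSite n V)) =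
      ((1 : ℝ) : ℂ) • (1 : Alg) := by
    simp only [← ofMat_star, ← ofMat_mul, ← ofMat_add]
    rw [lastSite_star_mul_self_add, ofMat_one, Complex.ofReal_one, one_smul]
  refine ContinuousLinearMap.opNorm_le_bound _ zero_le_one fun ξ => ?_
  induction ξ using UniformSpace.Completion.induction_on with
  | hp => exact isClosed_le (by fun_prop) (by fun_prop)
  | ih x =>
    rw [Vop, leftRep_coe, UniformSpace.Completion.norm_coe, UniformSpace.Completion.norm_coe]
    simpa using norm_mul_le_of_star_mul_self_add h0 x

/-- The operator `A = ∑_{n ≥ 1} αⁿ Vₙ` with `Vₙ = 1^{⊗ (n-1)} ⊗ V`, a series that converges in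
operator norm for `|α| < 1` (the summation index below is `n - 1`). -/
def A (α : ℝ) : L2 →L[ℂ] L2 := ∑' n : ℕ, ((α : ℂ) ^ (n + 1)) • Vop n

/-- For `0 < α < 1` the series that defines `A α` is indeed norm convergent. -/
theorem hasSum_A {α : ℝ} (h0 : 0 < α) (h1 : α < 1) :
    HasSum (fun n : ℕ => ((α : ℂ) ^ (n + 1)) • Vop n) (A α) := by
  refine Summable.hasSum (Summable.of_norm_bounded
    ((summable_geometric_of_lt_one h0.le h1).mul_left α) fun n => ?_)
  rw [norm_smul, norm_pow, Complex.norm_real, Real.norm_of_nonneg h0.le, ← pow_succ']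
  exact mul_le_of_le_one_right (by positivity) (norm_Vop_le n)

/-- `ℰᵣ(T) = {ξ : limsup γₙ ‖Tⁿ ξ‖^{1/n} ≤ r}`; the `limsup` is taken in `[-∞, ∞]`. -/
def localSet (γ : ℕ → ℝ) (r : ℝ) (T : L2 →L[ℂ] L2) : Set L2 :=
  {ξ | limsup (fun n : ℕ => ((γ n * ‖(T ^ n) ξ‖ ^ (1 / (n : ℝ)) : ℝ) : EReal)) atTop ≤ (r : EReal)}

/-- `ℋᵣ(T)`, the norm closure of `ℰᵣ(T)`. -/
def localSubspace (γ : ℕ → ℝ) (r : ℝ) (T : L2 →L[ℂ] L2) : Set L2 := closure (localSet γ r T)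

end HyperfiniteFactor

end

/-!
Write `E = ℰᵣ(A)` and `H` for its closure. Membership in `E` is not affected by polynomial factors,
since `n`-th roots are taken, so `E` is a linear subspace and is invariant under every bounded
operator commuting with `A`: under all right multiplications, under `A` and under all `Vⱼ`. A closed
subspace invariant under right multiplications, all `Vⱼ` and all `Vⱼ*` is trivial, because its
projection lies in the centre of the factor `ℛ` (`eq_bot_or_eq_top_of_invariant`). What has to be
shown is thus that `Vⱼ*` maps `H` into itself.

The operators `Vⱼ*`, `[A, Vⱼ*]` and `[A, [A, Vⱼ*]]` satisfy the relations of `sl₂`: the last is a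
multiple of `Vⱼ` and commutes with `A`. Hence `Aⁿ⁺² Vⱼ* = Bₙ Aⁿ` with `‖Bₙ‖` of quadratic growth
(`pow_mul_of_commutators`), so that `‖Aⁿ Vⱼ* A² ξ‖ ≤ C n² ‖Aⁿ ξ‖` and `Vⱼ* A²` maps `E` into itself
(`star_site_pow_two_mem_localSet`). No regularity of `γ` enters, because the exponent is the same on
both sides.

The factor `A²` is removed with the finiteness of `ℛ`. If `A` is injective, then `A H` is dense in
`H` (`RightModular.le_closure_map`): with `P` the projection onto `H`, the kernels of `A P` and
`(A P)*` have projections of equal trace, and one contains the other. The equality of traces is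
obtained without polar decomposition. For small `c > 0` the contractions `1 - c S*S` and
`1 - c SS*` have powers of equal traces, and by the mean ergodic theorem the averages of their powers
converge to the projections onto `ker S` and `ker S*`. If `A` is not injective, then the union of the
kernels of the powers of `A` is a nonzero subspace of `E`, and `Vⱼ* ker Aⁿ ⊆ ker Aⁿ⁺²` shows that its
closure is invariant under everything, hence is the whole space.
-/

open Filter

noncomputable section

namespace HyperfiniteFactor

open Topology ContinuousLinearMap

/-! ### The left and right regular representations -/

theorem clm_mul_apply (S T : L2 →L[ℂ] L2) (ξ : L2) : (S * T) ξ = S (T ξ) := rfl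

theorem trace_mul_comm (a b : Alg) : trace (a * b) = trace (b * a) := by
  obtain ⟨n, x, y, rfl, rfl⟩ := exists_ofMat₂ a b
  rw [← ofMat_mul, ← ofMat_mul, trace_ofMat, trace_ofMat, normTrace, normTrace,
    Matrix.trace_mul_comm]

theorem inner_star_star (a b : Alg) : inner ℂ (star a) (star b) = inner ℂ b a := by
  rw [inner_def, inner_def, star_star, trace_mul_comm]

theorem norm_star_alg (a : Alg) : ‖star a‖ = ‖a‖ := by
  rw [@norm_eq_sqrt_re_inner ℂ, inner_star_star, ← @norm_eq_sqrt_re_inner ℂ]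

theorem leftMul_apply (a x : Alg) : leftMul a x = a * x := rfl

/-- Right multiplication by `a` as a `‖·‖₂`-bounded operator on `Alg`; its norm is that of left
multiplication by `star a`, because `star` is isometric. -/
def rightMul (a : Alg) : Alg →L[ℂ] Alg :=
  (LinearMap.mulRight ℂ a).mkContinuousOfExistsBound ⟨‖leftMul (star a)‖, fun x => by
    have h := (leftMul (star a)).le_opNorm (star x)
    rwa [leftMul_apply, ← star_mul, norm_star_alg, norm_star_alg] at h⟩

/-- The action of `Alg` on `L²(ℛ, τ)` by right multiplication: `rightRep a` extends `x ↦ x a`. -/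
def rightRep (a : Alg) : L2 →L[ℂ] L2 := (rightMul a).completion

theorem rightRep_coe (a x : Alg) : rightRep a (x : L2) = ((x * a : Alg) : L2) :=
  ContinuousLinearMap.completion_apply_coe _ _

/-- Two bounded operators agreeing on the dense image of `Alg` are equal. -/
theorem clm_ext {S T : L2 →L[ℂ] L2} (h : ∀ x : Alg, S (x : L2) = T (x : L2)) : S = T := by
  ext ξ
  induction ξ using UniformSpace.Completion.induction_on with
  | hp => exact isClosed_eq S.continuous T.continuous
  | ih x => exact h x

theorem leftRep_mul (a b : Alg) : leftRep (a * b) = leftRep a * leftRep b :=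
  clm_ext fun x => by simp only [clm_mul_apply, leftRep_coe, mul_assoc]

theorem leftRep_add (a b : Alg) : leftRep (a + b) = leftRep a + leftRep b :=
  clm_ext fun x => by
    simp only [add_apply, leftRep_coe, add_mul, UniformSpace.Completion.coe_add]

theorem leftRep_sub (a b : Alg) : leftRep (a - b) = leftRep a - leftRep b := by
  rw [eq_sub_iff_add_eq, ← leftRep_add, sub_add_cancel]

theorem leftRep_smul (c : ℂ) (a : Alg) : leftRep (c • a) = c • leftRep a :=
  clm_ext fun x => by
    simp only [smul_apply, leftRep_coe, smul_mul_assoc, UniformSpace.Completion.coe_smul]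

theorem leftRep_mul_rightRep (a b : Alg) : leftRep a * rightRep b = rightRep b * leftRep a :=
  clm_ext fun x => by simp only [clm_mul_apply, leftRep_coe, rightRep_coe, mul_assoc]

theorem adjoint_leftRep (a : Alg) : adjoint (leftRep a) = leftRep (star a) := by
  refine ((eq_adjoint_iff _ _).2 fun ξ η => ?_).symm
  induction ξ, η using UniformSpace.Completion.induction_on₂ with
  | hp => exact isClosed_eq (by fun_prop) (by fun_prop)
  | ih x y =>
    rw [leftRep_coe, leftRep_coe, UniformSpace.Completion.inner_coe,
      UniformSpace.Completion.inner_coe, inner_def, inner_def, star_mul, star_star, mul_assoc]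

theorem adjoint_rightRep (a : Alg) : adjoint (rightRep a) = rightRep (star a) := by
  refine ((eq_adjoint_iff _ _).2 fun ξ η => ?_).symm
  induction ξ, η using UniformSpace.Completion.induction_on₂ with
  | hp => exact isClosed_eq (by fun_prop) (by fun_prop)
  | ih x y =>
    rw [rightRep_coe, rightRep_coe, UniformSpace.Completion.inner_coe,
      UniformSpace.Completion.inner_coe, inner_def, inner_def, star_mul, star_star, mul_assoc,
      trace_mul_comm, mul_assoc]

/-! ### The trace on the commutant of the right action -/

/-- `T` commutes with all right multiplications, that is, `T` belongs to the von Neumann algebra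
`ℛ` acting by left multiplication. -/
def RightModular (T : L2 →L[ℂ] L2) : Prop := ∀ a : Alg, T * rightRep a = rightRep a * T

/-- The unit of `Alg` as the trace vector of `L²(ℛ, τ)`. -/
def traceVec : L2 := ((1 : Alg) : L2)

theorem rightRep_traceVec (a : Alg) : rightRep a traceVec = (a : L2) := by
  rw [traceVec, rightRep_coe, one_mul]

theorem leftRep_traceVec (a : Alg) : leftRep a traceVec = (a : L2) := by
  rw [traceVec, leftRep_coe, mul_one]

theorem RightModular.apply_coe {T : L2 →L[ℂ] L2} (hT : RightModular T) (a : Alg) :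
    T (a : L2) = rightRep a (T traceVec) := by
  rw [← rightRep_traceVec, ← clm_mul_apply, hT a, clm_mul_apply]

/-- The trace vector is separating for the commutant of the right action. -/
theorem RightModular.ext {S T : L2 →L[ℂ] L2} (hS : RightModular S) (hT : RightModular T)
    (h : S traceVec = T traceVec) : S = T :=
  clm_ext fun x => by rw [hS.apply_coe, hT.apply_coe, h]

theorem rightModular_leftRep (a : Alg) : RightModular (leftRep a) := leftRep_mul_rightRep a

theorem RightModular.one : RightModular 1 := fun a => by rw [one_mul, mul_one]

theorem RightModular.mul {S T : L2 →L[ℂ] L2} (hS : RightModular S) (hT : RightModular T) :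
    RightModular (S * T) := fun a => by rw [mul_assoc, hT a, ← mul_assoc, hS a, mul_assoc]

theorem RightModular.sub {S T : L2 →L[ℂ] L2} (hS : RightModular S) (hT : RightModular T) :
    RightModular (S - T) := fun a => by rw [sub_mul, hS a, hT a, mul_sub]

theorem RightModular.smul {T : L2 →L[ℂ] L2} (hT : RightModular T) (c : ℂ) :
    RightModular (c • T) := fun a => by rw [smul_mul_assoc, hT a, mul_smul_comm]

theorem RightModular.pow {T : L2 →L[ℂ] L2} (hT : RightModular T) (n : ℕ) :
    RightModular (T ^ n) := fun a => (Commute.pow_left (hT a) n : _)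

theorem RightModular.adjoint {T : L2 →L[ℂ] L2} (hT : RightModular T) :
    RightModular (adjoint T) := fun a => by
  have h := congrArg ContinuousLinearMap.adjoint (hT (star a))
  simp only [← star_eq_adjoint, star_mul] at h
  simp only [star_eq_adjoint, adjoint_rightRep, star_star] at h
  exact h.symm

theorem rightModular_starProjection (K : Submodule ℂ L2) [K.HasOrthogonalProjection]
    (hK : ∀ a, ∀ ξ ∈ K, rightRep a ξ ∈ K) : RightModular K.starProjection := by
  intro a
  ext ξ
  simp only [clm_mul_apply]
  refine (K.eq_starProjection_of_mem_orthogonal (hK a _ (K.starProjection_apply_mem ξ)) ?_)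
  rw [← map_sub, Submodule.mem_orthogonal]
  intro η hη
  rw [← adjoint_inner_left, adjoint_rightRep]
  exact (Submodule.mem_orthogonal _ _).1 (K.sub_starProjection_mem_orthogonal ξ) _ (hK _ _ hη)

theorem uniformContinuous_star_alg : UniformContinuous (star : Alg → Alg) :=
  (LipschitzWith.of_dist_le_mul (K := 1) fun a b => by
    rw [dist_eq_norm, dist_eq_norm, ← star_sub, norm_star_alg]; simp).uniformContinuous

/-- The modular conjugation: the isometric extension of `a ↦ a*` to `L²(ℛ, τ)`. -/
def conjL2 : L2 → L2 := UniformSpace.Completion.map star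

theorem continuous_conjL2 : Continuous conjL2 := UniformSpace.Completion.continuous_map

theorem conjL2_coe (a : Alg) : conjL2 (a : L2) = ((star a : Alg) : L2) :=
  UniformSpace.Completion.map_coe uniformContinuous_star_alg a

theorem inner_conjL2_conjL2 (ξ η : L2) : inner ℂ (conjL2 ξ) (conjL2 η) = inner ℂ η ξ := by
  have := continuous_conjL2
  induction ξ, η using UniformSpace.Completion.induction_on₂ with
  | hp => exact isClosed_eq (by fun_prop) (by fun_prop)
  | ih x y =>
    rw [conjL2_coe, conjL2_coe, UniformSpace.Completion.inner_coe,
      UniformSpace.Completion.inner_coe, inner_star_star]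

theorem conjL2_conjL2 (ξ : L2) : conjL2 (conjL2 ξ) = ξ := by
  have := continuous_conjL2
  induction ξ using UniformSpace.Completion.induction_on with
  | hp => exact isClosed_eq (by fun_prop) (by fun_prop)
  | ih x => rw [conjL2_coe, conjL2_coe, star_star]

/-- A vector of `L²(ℛ, τ)` is determined by its inner products with the elements of `Alg`. -/
theorem ext_inner_coe {ξ η : L2} (h : ∀ a : Alg, inner ℂ (a : L2) ξ = inner ℂ (a : L2) η) :
    ξ = η := by
  refine ext_inner_left ℂ fun ζ => ?_
  induction ζ using UniformSpace.Completion.induction_on with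
  | hp => exact isClosed_eq (by fun_prop) (by fun_prop)
  | ih x => exact h x

theorem RightModular.conjL2_apply {T : L2 →L[ℂ] L2} (hT : RightModular T) :
    conjL2 (T traceVec) = ContinuousLinearMap.adjoint T traceVec := by
  refine ext_inner_coe fun a => ?_
  rw [adjoint_inner_right, hT.apply_coe, ← adjoint_inner_right, adjoint_rightRep,
    rightRep_traceVec, ← inner_conjL2_conjL2, conjL2_conjL2, conjL2_coe]

/-- The vector state of `traceVec` is a trace on the commutant of the right action: this is the
finiteness of `ℛ`. -/
theorem RightModular.trace_comm {S T : L2 →L[ℂ] L2} (hS : RightModular S) (hT : RightModular T) :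
    inner ℂ traceVec ((S * T) traceVec) = inner ℂ traceVec ((T * S) traceVec) := by
  rw [clm_mul_apply, clm_mul_apply, ← adjoint_inner_left S (T traceVec) traceVec,
    ← adjoint_inner_left T (S traceVec) traceVec, ← hS.conjL2_apply,
    ← hT.conjL2_apply, ← inner_conjL2_conjL2, conjL2_conjL2]

/-! ### Injective operators of a finite von Neumann algebra have dense range -/

theorem clm_pow_apply (f : L2 →L[ℂ] L2) (n : ℕ) (ξ : L2) : (f ^ n) ξ = f^[n] ξ := by
  induction n with
  | zero => rfl
  | succ n ih => rw [pow_succ', Function.iterate_succ_apply', clm_mul_apply, ih]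

/-- With `‖S‖² c ≤ 1`, the operator `1 - c S*S` is a contraction. -/
theorem norm_one_sub_smul_adjoint_mul_self_le {S : L2 →L[ℂ] L2} {c : ℝ} (hc : 0 ≤ c)
    (h : c * ‖S‖ ^ 2 ≤ 1) : ‖1 - (c : ℂ) • (adjoint S * S)‖ ≤ 1 := by
  refine opNorm_le_bound _ zero_le_one fun ξ => ?_
  rw [one_mul]
  refine le_of_sq_le_sq ?_ (norm_nonneg ξ)
  have e : (1 - (c : ℂ) • (adjoint S * S)) ξ = ξ - (c : ℂ) • adjoint S (S ξ) := rfl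
  have h1 : RCLike.re (inner ℂ ξ ((c : ℂ) • adjoint S (S ξ))) = c * ‖S ξ‖ ^ 2 := by
    rw [inner_smul_right, adjoint_inner_right, inner_self_eq_norm_sq_to_K]
    change ((c : ℂ) * ((‖S ξ‖ : ℝ) : ℂ) ^ 2).re = _
    rw [← Complex.ofReal_pow, ← Complex.ofReal_mul, Complex.ofReal_re]
  have h2 : ‖adjoint S (S ξ)‖ ≤ ‖S‖ * ‖S ξ‖ := by
    simpa using (adjoint S).le_opNorm (S ξ)
  have h3 : ‖(c : ℂ) • adjoint S (S ξ)‖ ^ 2 ≤ c * ‖S ξ‖ ^ 2 := by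
    rw [norm_smul, Complex.norm_real, Real.norm_of_nonneg hc, mul_pow]
    calc c ^ 2 * ‖adjoint S (S ξ)‖ ^ 2 ≤ c ^ 2 * (‖S‖ * ‖S ξ‖) ^ 2 := by gcongr
      _ = c * (c * ‖S‖ ^ 2) * ‖S ξ‖ ^ 2 := by ring
      _ ≤ c * 1 * ‖S ξ‖ ^ 2 := by gcongr
      _ = _ := by ring
  rw [e, @norm_sub_sq ℂ, h1]
  nlinarith [mul_nonneg hc (sq_nonneg ‖S ξ‖)]

theorem one_sub_smul_adjoint_mul_self_apply_eq_iff {S : L2 →L[ℂ] L2} {c : ℝ} (hc : 0 < c)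
    (ξ : L2) : (1 - (c : ℂ) • (adjoint S * S)) ξ = ξ ↔ S ξ = 0 := by
  have e : (1 - (c : ℂ) • (adjoint S * S)) ξ = ξ - (c : ℂ) • adjoint S (S ξ) := rfl
  rw [e, sub_eq_self, smul_eq_zero_iff_right (by exact_mod_cast hc.ne')]
  refine ⟨fun h => ?_, fun h => by rw [h, map_zero]⟩
  rw [← inner_self_eq_zero (𝕜 := ℂ), ← adjoint_inner_right, h, inner_zero_right]

/-- The powers of `1 - c S*S` and of `1 - c SS*` have equal traces. -/
theorem RightModular.trace_pow_one_sub {S : L2 →L[ℂ] L2} (hS : RightModular S) (c : ℂ) (n : ℕ) :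
    inner ℂ traceVec (((1 - c • (ContinuousLinearMap.adjoint S * S)) ^ n) traceVec) =
      inner ℂ traceVec (((1 - c • (S * ContinuousLinearMap.adjoint S)) ^ n) traceVec) := by
  set R := ContinuousLinearMap.adjoint S
  have hR : RightModular R := hS.adjoint
  set f := 1 - c • (R * S) with hf
  set g := 1 - c • (S * R) with hg
  have hgm : RightModular g := RightModular.one.sub ((hS.mul hR).smul c)
  have hcom : SemiconjBy R g f := by
    simp only [SemiconjBy, hf, hg, mul_sub, sub_mul, mul_one, one_mul, mul_smul_comm,
      smul_mul_assoc, mul_assoc]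
  induction n with
  | zero => simp only [pow_zero]
  | succ n ih =>
    have e1 : f ^ (n + 1) = f ^ n - c • (R * (g ^ n * S)) := by
      rw [pow_succ, hf, mul_sub, mul_one, mul_smul_comm, ← hf, ← mul_assoc, ← mul_assoc,
        (hcom.pow_right n).eq]
    have e2 : g ^ (n + 1) = g ^ n - c • (g ^ n * S * R) := by
      rw [pow_succ, hg, mul_sub, mul_one, mul_smul_comm, ← hg, mul_assoc]
    rw [e1, e2, sub_apply, sub_apply, smul_apply, smul_apply, inner_sub_right, inner_sub_right,
      inner_smul_right, inner_smul_right, ih, hR.trace_comm ((hgm.pow n).mul hS)]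

/-- The kernels of `S` and `S*` have projections of equal trace. By the mean ergodic theorem these
projections are the limits of the averages of the powers of the contractions `1 - c S*S` and
`1 - c SS*`. -/
theorem RightModular.trace_starProjection_ker {S : L2 →L[ℂ] L2} (hS : RightModular S)
    (K L : Submodule ℂ L2) [K.HasOrthogonalProjection] [L.HasOrthogonalProjection]
    (hK : ∀ ξ, ξ ∈ K ↔ S ξ = 0) (hL : ∀ ξ, ξ ∈ L ↔ ContinuousLinearMap.adjoint S ξ = 0) :
    inner ℂ traceVec (K.starProjection traceVec) = inner ℂ traceVec (L.starProjection traceVec) := by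
  set R := ContinuousLinearMap.adjoint S with hR
  have hRS : ContinuousLinearMap.adjoint R = S := adjoint_adjoint S
  obtain ⟨c, hc, hcS⟩ : ∃ c : ℝ, 0 < c ∧ c * ‖S‖ ^ 2 ≤ 1 := by
    refine ⟨(‖S‖ ^ 2 + 1)⁻¹, by positivity, ?_⟩
    rw [inv_mul_le_iff₀ (by positivity)]
    linarith
  have key : ∀ (T : L2 →L[ℂ] L2) (M : Submodule ℂ L2) [M.HasOrthogonalProjection],
      c * ‖T‖ ^ 2 ≤ 1 → (∀ ξ, ξ ∈ M ↔ T ξ = 0) →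
      Tendsto (fun N : ℕ => ((N : ℂ)⁻¹ • ∑ n ∈ Finset.range N, inner ℂ traceVec
        (((1 - (c : ℂ) • (ContinuousLinearMap.adjoint T * T)) ^ n) traceVec))) atTop
        (𝓝 (inner ℂ traceVec (M.starProjection traceVec))) := by
    intro T M _ hT hM
    set f := 1 - (c : ℂ) • (ContinuousLinearMap.adjoint T * T) with hf
    have hfM : f.eqLocus (1 : L2 →L[ℂ] L2) = M := by
      ext ξ
      rw [hM, ← one_sub_smul_adjoint_mul_self_apply_eq_iff hc, ← hf]
      rfl
    have h1 := f.tendsto_birkhoffAverage_orthogonalProjection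
      (norm_one_sub_smul_adjoint_mul_self_le hc.le hT) traceVec
    have h2 : (((f.eqLocus (1 : L2 →L[ℂ] L2)).orthogonalProjectionOnto traceVec : _) : L2) =
        M.starProjection traceVec := by
      subst hfM
      rfl
    rw [h2] at h1
    have h3 := ((innerSL ℂ traceVec).continuous.tendsto _).comp h1
    refine h3.congr fun N => ?_
    simp only [Function.comp_apply, birkhoffAverage, birkhoffSum, id, innerSL_apply_apply,
      inner_smul_right, inner_sum, smul_eq_mul]
    congr 1
    refine Finset.sum_congr rfl fun n _ => ?_
    rw [clm_pow_apply]
  have h1 := key S K hcS hK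
  have h2 := key R L (by rwa [hR, LinearIsometryEquiv.norm_map]) hL
  rw [hRS] at h2
  refine tendsto_nhds_unique h1 (h2.congr fun N => ?_)
  simp only [hS.trace_pow_one_sub, hR]

/-- For comparable right-invariant closed subspaces, equality of traces forces equality. -/
theorem eq_of_le_of_trace_eq {K L : Submodule ℂ L2} [K.HasOrthogonalProjection]
    [L.HasOrthogonalProjection] (hKL : K ≤ L) (hK : RightModular K.starProjection)
    (hL : RightModular L.starProjection)
    (h : inner ℂ traceVec (K.starProjection traceVec) =
      inner ℂ traceVec (L.starProjection traceVec)) : K = L := by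
  have h1 : K.starProjection (L.starProjection traceVec) = K.starProjection traceVec :=
    congrArg Subtype.val (K.orthogonalProjectionOnto_starProjection_of_le hKL traceVec)
  have h2 : L.starProjection traceVec - K.starProjection traceVec = 0 := by
    have e : ∀ (M : Submodule ℂ L2) [M.HasOrthogonalProjection],
        inner ℂ traceVec (M.starProjection traceVec) =
          inner ℂ (M.starProjection traceVec) (M.starProjection traceVec) := fun M _ => by
      rw [Submodule.inner_starProjection_left_eq_right,
        M.starProjection_eq_self_iff.2 (M.starProjection_apply_mem _)]
    have e3 : inner ℂ (K.starProjection traceVec) (L.starProjection traceVec) =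
        inner ℂ (K.starProjection traceVec) (K.starProjection traceVec) := by
      rw [← e, Submodule.inner_starProjection_left_eq_right, h1]
    have e4 : inner ℂ (L.starProjection traceVec) (K.starProjection traceVec) =
        inner ℂ (K.starProjection traceVec) (K.starProjection traceVec) := by
      rw [← inner_conj_symm, e3, inner_conj_symm]
    rw [← inner_self_eq_zero (𝕜 := ℂ), inner_sub_left, inner_sub_right, inner_sub_right, e3, e4,
      ← e, ← e, h]
    ring
  have h3 : K.starProjection = L.starProjection := hK.ext hL (sub_eq_zero.1 h2).symm
  refine le_antisymm hKL fun ξ hξ => ?_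
  rw [← K.starProjection_eq_self_iff, h3, L.starProjection_eq_self_iff]
  exact hξ

/-- An injective operator of `ℛ` maps any closed right-invariant subspace `K` which it leaves
invariant onto a dense subspace of `K`: with `P` the projection onto `K`, the kernels of
`T P` and `(T P)*` are `Kᗮ` and the complement of the range, and they have equal traces. -/
theorem RightModular.le_closure_map {T : L2 →L[ℂ] L2} (hT : RightModular T)
    (hinj : ∀ ξ, T ξ = 0 → ξ = 0) (K : Submodule ℂ L2) [K.HasOrthogonalProjection]
    (hK : ∀ a, ∀ ξ ∈ K, rightRep a ξ ∈ K) (hTK : ∀ ξ ∈ K, T ξ ∈ K) :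
    K ≤ (K.map (T : L2 →ₗ[ℂ] L2)).topologicalClosure := by
  have hP := rightModular_starProjection K hK
  set S := T * K.starProjection with hSdef
  have hS : RightModular S := hT.mul hP
  have hrange : ∀ ξ, S ξ ∈ K := fun ξ => hTK _ (K.starProjection_apply_mem ξ)
  have hker : ∀ ξ, ξ ∈ Kᗮ ↔ S ξ = 0 := by
    intro ξ
    rw [← Submodule.starProjection_apply_eq_zero_iff]
    exact ⟨fun h => by rw [hSdef, clm_mul_apply, h, map_zero], fun h => hinj _ h⟩
  let L : Submodule ℂ L2 := (ContinuousLinearMap.adjoint S).ker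
  have hLc : IsClosed (L : Set L2) := (ContinuousLinearMap.adjoint S).isClosed_ker
  have : CompleteSpace L := hLc.completeSpace_coe
  have hL : ∀ ξ, ξ ∈ L ↔ ContinuousLinearMap.adjoint S ξ = 0 := fun ξ => LinearMap.mem_ker
  have hLinv : ∀ a, ∀ ξ ∈ L, rightRep a ξ ∈ L := fun a ξ hξ => by
    rw [hL] at hξ ⊢
    rw [← clm_mul_apply, hS.adjoint a, clm_mul_apply, hξ, map_zero]
  have hKL : Kᗮ ≤ L := fun ξ hξ => by
    rw [hL]
    refine ext_inner_left ℂ fun η => ?_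
    rw [adjoint_inner_right, inner_zero_right]
    exact (Submodule.mem_orthogonal _ _).1 hξ _ (hrange η)
  have hKo : RightModular Kᗮ.starProjection := by
    rw [Submodule.starProjection_orthogonal']
    exact RightModular.one.sub hP
  have heq : Kᗮ = L := eq_of_le_of_trace_eq hKL hKo (rightModular_starProjection L hLinv)
    (hS.trace_starProjection_ker _ _ hker hL)
  rw [← Submodule.orthogonal_orthogonal_eq_closure]
  intro ξ hξ
  rw [Submodule.mem_orthogonal]
  intro η hη
  have hηL : η ∈ Kᗮ := by
    rw [heq, hL]
    refine ext_inner_left ℂ fun ζ => ?_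
    rw [adjoint_inner_right, inner_zero_right]
    exact (Submodule.mem_orthogonal _ _).1 hη _
      (Submodule.mem_map_of_mem (K.starProjection_apply_mem ζ))
  rw [← inner_conj_symm, (Submodule.mem_orthogonal _ _).1 hηL _ hξ, map_zero]

/-! ### The tensor factors of the algebra -/

/-- The elementary tensor `y ⊗ z` of `y` in `Mat n` and a two by two matrix `z`. -/
def tensorLast (n : ℕ) (y : Mat n) (z : Matrix (Fin 2) (Fin 2) ℂ) : Mat (n + 1) :=
  Matrix.of fun s t =>
    y (fun i => s i.castSucc) (fun i => t i.castSucc) * z (s (Fin.last n)) (t (Fin.last n))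

theorem tensorLast_apply (n : ℕ) (y : Mat n) (z : Matrix (Fin 2) (Fin 2) ℂ)
    (s t : Fin (n + 1) → Fin 2) : tensorLast n y z s t =
      y (fun i => s i.castSucc) (fun i => t i.castSucc) * z (s (Fin.last n)) (t (Fin.last n)) := rfl

theorem tensorLast_mul (n : ℕ) (y y' : Mat n) (z z' : Matrix (Fin 2) (Fin 2) ℂ) :
    tensorLast n y z * tensorLast n y' z' = tensorLast n (y * y') (z * z') := by
  ext s t
  rw [Matrix.mul_apply, ← (Fin.snocEquiv fun _ => Fin 2).sum_comp, Fintype.sum_prod_type,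
    tensorLast_apply, Matrix.mul_apply, Matrix.mul_apply, Finset.sum_mul_sum, Finset.sum_comm]
  refine Finset.sum_congr rfl fun p _ => Finset.sum_congr rfl fun j _ => ?_
  simp only [tensorLast_apply, Fin.snocEquiv, Equiv.coe_fn_mk, Fin.snoc_castSucc, Fin.snoc_last]
  ring

theorem lastSite_eq_tensorLast (n : ℕ) (z : Matrix (Fin 2) (Fin 2) ℂ) :
    lastSite n z = tensorLast n 1 z := by
  ext s t
  rw [lastSite_apply, tensorLast_apply, Matrix.one_apply, ite_mul, one_mul, zero_mul]
  exact if_congr funext_iff.symm rfl rfl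

theorem embed_eq_tensorLast (n : ℕ) (y : Mat n) :
    embed n (n + 1) n.le_succ y = tensorLast n y 1 := by
  ext s t
  rw [embed_apply, tensorLast_apply, Matrix.one_apply, mul_ite, mul_one, mul_zero]
  refine if_congr ⟨fun h => h _ le_rfl, fun h i hi => ?_⟩ rfl rfl
  rwa [show i = Fin.last n from Fin.ext (le_antisymm (Nat.lt_succ_iff.1 i.2) hi)]

/-- The element `1 ⊗ ⋯ ⊗ 1 ⊗ x ⊗ 1 ⊗ ⋯` of `Alg`, with `n` factors `1` before `x`. -/
def site (n : ℕ) (x : Matrix (Fin 2) (Fin 2) ℂ) : Alg := ofMat (n + 1) (lastSite n x)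

theorem ofMat_tensorLast (n : ℕ) (y : Mat n) (z : Matrix (Fin 2) (Fin 2) ℂ) :
    ofMat (n + 1) (tensorLast n y z) = ofMat n y * site n z := by
  rw [site, ← ofMat_embed n.le_succ y, embed_eq_tensorLast, lastSite_eq_tensorLast, ← ofMat_mul,
    tensorLast_mul, mul_one, one_mul]

theorem site_mul (n : ℕ) (x y : Matrix (Fin 2) (Fin 2) ℂ) :
    site n (x * y) = site n x * site n y := by
  rw [site, site, site, ← ofMat_mul]
  simp only [lastSite_eq_tensorLast, tensorLast_mul, one_mul]

theorem site_add (n : ℕ) (x y : Matrix (Fin 2) (Fin 2) ℂ) :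
    site n (x + y) = site n x + site n y := by
  rw [site, site, site, ← ofMat_add]
  congr 1
  ext s t
  simp only [lastSite_eq_tensorLast, tensorLast_apply, Matrix.add_apply, mul_add]

theorem site_smul (n : ℕ) (c : ℂ) (x : Matrix (Fin 2) (Fin 2) ℂ) :
    site n (c • x) = c • site n x := by
  rw [site, site, ← ofMat_smul]
  congr 1
  ext s t
  simp only [lastSite_eq_tensorLast, tensorLast_apply, Matrix.smul_apply, smul_eq_mul]
  ring

theorem star_site (n : ℕ) (x : Matrix (Fin 2) (Fin 2) ℂ) : star (site n x) = site n (star x) := by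
  rw [site, site, ← ofMat_star]
  congr 1
  ext s t
  simp only [lastSite_eq_tensorLast, tensorLast_apply, Matrix.star_apply, star_mul',
    Matrix.one_apply, eq_comm]
  split_ifs <;> simp

/-- Elements of distinct tensor factors commute. -/
theorem commute_site {i j : ℕ} (hij : i ≠ j) (x y : Matrix (Fin 2) (Fin 2) ℂ) :
    Commute (site i x) (site j y) := by
  have key : ∀ (i j : ℕ) (x y : Matrix (Fin 2) (Fin 2) ℂ), i < j →
      Commute (site i x) (site j y) := by
    intro i j x y h
    have e : site i x = ofMat (j + 1)
        (tensorLast j (embed (i + 1) j (Nat.succ_le_of_lt h) (lastSite i x)) 1) := by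
      rw [← embed_eq_tensorLast, ofMat_embed, ofMat_embed]
      rfl
    rw [e, site, lastSite_eq_tensorLast j y, Commute, SemiconjBy, ← ofMat_mul, ← ofMat_mul,
      tensorLast_mul, tensorLast_mul]
    simp only [one_mul, mul_one]
  rcases hij.lt_or_gt with h | h
  · exact key i j x y h
  · exact (key j i y x h).symm

theorem V_mul_V : V * V = 0 := by
  ext i j
  rw [Matrix.mul_apply]
  fin_cases i <;> fin_cases j <;> simp [V]

theorem V_mul_star_V_mul_V : V * star V * V = V := by
  ext i j
  simp only [Matrix.mul_apply, Matrix.star_apply]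
  fin_cases i <;> fin_cases j <;> simp [V]

/-- A two by two matrix in terms of `V` and `V*`, which generate `M₂(ℂ)`. -/
theorem eq_combination_V (x : Matrix (Fin 2) (Fin 2) ℂ) :
    x = x 0 0 • (V * star V) + x 0 1 • V + x 1 0 • star V + x 1 1 • (star V * V) := by
  ext i j
  simp only [Matrix.add_apply, Matrix.smul_apply, Matrix.mul_apply, Matrix.star_apply]
  fin_cases i <;> fin_cases j <;> simp [V]

/-- The elements `Vₙ` and `Vₙ*` generate `Alg`. -/
theorem mem_subalgebra_of_site_mem (S : Subalgebra ℂ Alg) (hV : ∀ n, site n V ∈ S)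
    (hW : ∀ n, site n (star V) ∈ S) (a : Alg) : a ∈ S := by
  have hsite : ∀ n x, site n x ∈ S := fun n x => by
    rw [eq_combination_V x]
    simp only [site_add, site_smul, site_mul]
    exact S.add_mem (S.add_mem (S.add_mem (S.smul_mem (S.mul_mem (hV n) (hW n)) _)
      (S.smul_mem (hV n) _)) (S.smul_mem (hW n) _)) (S.smul_mem (S.mul_mem (hW n) (hV n)) _)
  obtain ⟨n, x, rfl⟩ := exists_ofMat a
  induction n with
  | zero =>
    have e : x = x default default • (1 : Mat 0) := by
      ext s t
      rw [Subsingleton.elim s default, Subsingleton.elim t default, Matrix.smul_apply,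
        Matrix.one_apply_eq, smul_eq_mul, mul_one]
    rw [e, ofMat_smul, ofMat_one]
    exact S.smul_mem S.one_mem _
  | succ n ih =>
    let M : Submodule ℂ (Mat (n + 1)) :=
      { carrier := {x | ofMat (n + 1) x ∈ S}
        add_mem' := fun {x y} hx hy => by
          rw [Set.mem_ofPred_eq, ofMat_add]
          exact S.add_mem hx hy
        zero_mem' := by
          rw [Set.mem_ofPred_eq, ofMat_zero]
          exact S.zero_mem
        smul_mem' := fun c x hx => by
          rw [Set.mem_ofPred_eq, ofMat_smul]
          exact S.smul_mem hx c }
    have hT : ∀ y z, tensorLast n y z ∈ M := fun y z => by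
      change ofMat (n + 1) (tensorLast n y z) ∈ S
      rw [ofMat_tensorLast]
      exact S.mul_mem (ih y) (hsite n z)
    change x ∈ M
    rw [Matrix.matrix_eq_sum_single x]
    refine M.sum_mem fun s _ => M.sum_mem fun t _ => ?_
    have e : Matrix.single s t (x s t) = tensorLast n
        (Matrix.single (fun i => s i.castSucc) (fun i => t i.castSucc) (x s t))
        (Matrix.single (s (Fin.last n)) (t (Fin.last n)) 1) := by
      have hsnoc : ∀ p q : Fin (n + 1) → Fin 2, p = q ↔
          ((fun i : Fin n => p i.castSucc) = fun i => q i.castSucc) ∧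
            p (Fin.last n) = q (Fin.last n) := fun p q =>
        ⟨fun h => by subst h; exact ⟨rfl, rfl⟩,
          fun h => funext fun i => Fin.lastCases h.2 (congrFun h.1) i⟩
      ext p q
      have hs := hsnoc s p
      have ht := hsnoc t q
      rw [tensorLast_apply, Matrix.single_apply, Matrix.single_apply, Matrix.single_apply]
      split_ifs <;> first | (exfalso; tauto) | simp
    rw [e]
    exact hT _ _

/-! ### Reducing subspaces are trivial -/

/-- The centre of `ℛ` is trivial: a vector on which the left and the right action agree is a
multiple of the trace vector, because it defines a trace on every matrix algebra `Mat n`. -/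
theorem exists_eq_smul_traceVec {η : L2} (h : ∀ a, leftRep a η = rightRep a η) :
    ∃ c : ℂ, η = c • traceVec := by
  have htr : ∀ a b : Alg, inner ℂ ((a * b : Alg) : L2) η = inner ℂ ((b * a : Alg) : L2) η := by
    intro a b
    have e1 : inner ℂ ((a * b : Alg) : L2) η = inner ℂ (b : L2) (leftRep (star a) η) := by
      rw [← adjoint_leftRep, adjoint_inner_right, leftRep_coe]
    rw [e1, h, ← adjoint_rightRep, adjoint_inner_right, rightRep_coe]
  refine ⟨inner ℂ traceVec η, ext_inner_coe fun a => ?_⟩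
  obtain ⟨n, x, rfl⟩ := exists_ofMat a
  -- the conjugate-linear functional `x ↦ ⟪x, η⟫` on `Mat n`
  let φ : Mat n → ℂ := fun x => inner ℂ ((ofMat n x : Alg) : L2) η
  have hadd : ∀ x y, φ (x + y) = φ x + φ y := fun x y => by
    simp only [φ, ofMat_add, UniformSpace.Completion.coe_add, inner_add_left]
  have hsmul : ∀ (c : ℂ) x, φ (c • x) = star c * φ x := fun c x => by
    simp only [φ, ofMat_smul, UniformSpace.Completion.coe_smul, inner_smul_left]
    rfl
  have hmul : ∀ x y, φ (x * y) = φ (y * x) := fun x y => by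
    simp only [φ, ofMat_mul, htr]
  have hsum : ∀ {ι : Type} (s : Finset ι) (f : ι → Mat n), φ (∑ i ∈ s, f i) = ∑ i ∈ s, φ (f i) :=
    fun s f => map_sum (AddMonoidHom.mk' φ hadd) f s
  have hoff : ∀ s t : Fin n → Fin 2, s ≠ t → φ (Matrix.single s t 1) = 0 := fun s t hst => by
    have e : Matrix.single s t (1 : ℂ) = Matrix.single s s 1 * Matrix.single s t 1 := by
      rw [Matrix.single_mul_single_same, one_mul]
    have h0 : φ 0 = 0 := (AddMonoidHom.mk' φ hadd).map_zero
    rw [e, hmul, Matrix.single_mul_single_of_ne _ _ _ _ hst.symm, h0]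
  have hdiag : ∀ s t : Fin n → Fin 2,
      φ (Matrix.single s s 1) = φ (Matrix.single t t 1) := fun s t => by
    have e1 : Matrix.single s s (1 : ℂ) = Matrix.single s t 1 * Matrix.single t s 1 := by
      rw [Matrix.single_mul_single_same, one_mul]
    rw [e1, hmul, Matrix.single_mul_single_same, one_mul]
  obtain ⟨d, hd⟩ : ∃ d, ∀ s, φ (Matrix.single s s 1) = d := ⟨_, fun s => hdiag s 0⟩
  have hφ : ∀ y, φ y = star (Matrix.trace y) * d := fun y => by
    conv_lhs => rw [Matrix.matrix_eq_sum_single y]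
    rw [hsum, Matrix.trace, star_sum, Finset.sum_mul]
    refine Finset.sum_congr rfl fun s _ => ?_
    rw [hsum, Finset.sum_eq_single s]
    · rw [← hd s, ← hsmul, Matrix.smul_single, smul_eq_mul, mul_one, Matrix.diag_apply]
    · intro t _ hst
      have e : Matrix.single s t (y s t) = y s t • Matrix.single s t (1 : ℂ) := by
        rw [Matrix.smul_single, smul_eq_mul, mul_one]
      rw [e, hsmul, hoff s t hst.symm, mul_zero]
    · exact fun hs => absurd (Finset.mem_univ s) hs
  have hone : inner ℂ traceVec η = 2 ^ n * d := by
    have h1 : inner ℂ traceVec η = φ 1 := by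
      simp only [φ, ofMat_one]
      rfl
    rw [h1, hφ, Matrix.trace_one]
    simp
  have hx : inner ℂ ((ofMat n x : Alg) : L2) traceVec = (2 ^ n : ℂ)⁻¹ * star (Matrix.trace x) := by
    rw [traceVec, UniformSpace.Completion.inner_coe, inner_def, mul_one, trace_star, trace_ofMat,
      normTrace, star_mul']
    simp
  change φ x = _
  rw [hφ, inner_smul_right, hone, hx]
  field_simp

/-- A closed subspace which is invariant under all `Vₙ`, all `Vₙ*` and the right action is
trivial. -/
theorem eq_bot_or_eq_top_of_invariant (K : Submodule ℂ L2) (hc : IsClosed (K : Set L2))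
    (hR : ∀ a, ∀ ξ ∈ K, rightRep a ξ ∈ K)
    (hV : ∀ n, ∀ ξ ∈ K, leftRep (site n V) ξ ∈ K)
    (hW : ∀ n, ∀ ξ ∈ K, leftRep (site n (star V)) ξ ∈ K) : K = ⊥ ∨ K = ⊤ := by
  have : CompleteSpace K := hc.completeSpace_coe
  let S : Subalgebra ℂ Alg :=
    { carrier := {a | ∀ ξ ∈ K, leftRep a ξ ∈ K}
      mul_mem' := fun {a b} ha hb ξ hξ => by
        rw [leftRep_mul]
        exact ha _ (hb ξ hξ)
      add_mem' := fun {a b} ha hb ξ hξ => by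
        rw [leftRep_add]
        exact K.add_mem (ha ξ hξ) (hb ξ hξ)
      algebraMap_mem' := fun c ξ hξ => by
        have e : leftRep (1 : Alg) = 1 := clm_ext fun x => by
          rw [leftRep_coe, one_mul]
          rfl
        rw [Algebra.algebraMap_eq_smul_one, leftRep_smul, e]
        exact K.smul_mem c hξ }
  have hL : ∀ a, ∀ ξ ∈ K, leftRep a ξ ∈ K := mem_subalgebra_of_site_mem S hV hW
  have hP := rightModular_starProjection K hR
  have hPL : ∀ a ξ, K.starProjection (leftRep a ξ) = leftRep a (K.starProjection ξ) := by
    intro a ξ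
    refine (K.eq_starProjection_of_mem_orthogonal (hL a _ (K.starProjection_apply_mem ξ)) ?_)
    rw [← map_sub, Submodule.mem_orthogonal]
    intro η hη
    rw [← adjoint_inner_left, adjoint_leftRep]
    exact (Submodule.mem_orthogonal _ _).1 (K.sub_starProjection_mem_orthogonal ξ) _ (hL _ _ hη)
  obtain ⟨c, hc⟩ := exists_eq_smul_traceVec (η := K.starProjection traceVec) fun a => by
    rw [← hPL, leftRep_traceVec, hP.apply_coe]
  have hPc : K.starProjection = c • 1 := hP.ext (RightModular.one.smul c) hc
  have hval : ∀ ξ, K.starProjection ξ = c • ξ := fun ξ => by rw [hPc]; rfl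
  by_cases h0 : c = 0
  · left
    rw [Submodule.eq_bot_iff]
    intro ξ hξ
    rw [← K.starProjection_eq_self_iff.2 hξ, hval, h0, zero_smul]
  · right
    rw [Submodule.eq_top_iff']
    intro ξ
    have h1 := K.starProjection_apply_mem ξ
    rw [hval] at h1
    exact (K.smul_mem_iff h0).1 h1

/-! ### Commutation relations for the operator -/

section Commutation

variable {R : Type*} [Ring R] [Algebra ℂ R]

/-- If `[A, W] = h`, `[A, h] = -2 u` and `[A, u] = 0`, then moving a power of `A` from the left of
`W` to the right costs at most two factors `A` and a coefficient quadratic in the exponent. -/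
theorem pow_mul_of_commutators {A W h u : R} (hW : A * W = W * A + h)
    (hh : A * h = h * A - (2 : ℂ) • u) (hu : A * u = u * A) (n : ℕ) :
    A ^ (n + 2) * W = (W * A ^ 2 + (n + 2 : ℂ) • (h * A) - ((n + 2) * (n + 1) : ℂ) • u) * A ^ n := by
  -- the left factor with `m = n + 2`: its coefficients are `m` and `2 * (m choose 2)`
  have step : ∀ m : ℂ, A * (W * A ^ 2 + m • (h * A) - (m * (m - 1)) • u) =
      (W * A ^ 2 + (m + 1) • (h * A) - ((m + 1) * m) • u) * A := by
    intro m
    have e1 : A * (W * A ^ 2) = W * A ^ 3 + h * A ^ 2 := by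
      rw [← mul_assoc, hW, add_mul]; noncomm_ring
    have e2 : A * (h * A) = h * A ^ 2 - (2 : ℂ) • (u * A) := by
      rw [← mul_assoc, hh, sub_mul, smul_mul_assoc]; noncomm_ring
    have e3 : W * A ^ 2 * A = W * A ^ 3 := by noncomm_ring
    have e4 : h * A * A = h * A ^ 2 := by noncomm_ring
    simp only [mul_sub, mul_add, sub_mul, add_mul, mul_smul_comm, smul_mul_assoc, e1, e2, e3, e4, hu]
    module
  induction n with
  | zero =>
    have e : A ^ 2 * W = W * A ^ 2 + (2 : ℂ) • (h * A) - (2 : ℂ) • u := by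
      rw [pow_two, mul_assoc, hW, mul_add, ← mul_assoc, hW, hh, add_mul, mul_assoc]
      module
    rw [pow_zero, mul_one, zero_add, e, Nat.cast_zero, zero_add, zero_add, mul_one]
  | succ n ih =>
    have h1 := step (n + 2)
    rw [show n + 1 + 2 = (n + 2) + 1 from rfl, pow_succ' A (n + 2), mul_assoc, ih, ← mul_assoc,
      show ((n + 2 : ℂ) * (n + 1)) = (n + 2) * (n + 2 - 1) by ring, h1, pow_succ' A n, mul_assoc]
    push_cast
    rw [← mul_assoc, ← mul_assoc]
    ring_nf

end Commutation

theorem Vop_eq (n : ℕ) : Vop n = leftRep (site n V) := rfl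

theorem commute_A {α : ℝ} (h0 : 0 < α) (h1 : α < 1) {T : L2 →L[ℂ] L2}
    (hT : ∀ n, Commute (Vop n) T) : Commute (A α) T := by
  have hs := hasSum_A h0 h1
  have hl := hs.mul_right T
  have hr := hs.mul_left T
  have e : (fun n : ℕ => ((α : ℂ) ^ (n + 1)) • Vop n * T) =
      fun n : ℕ => T * ((α : ℂ) ^ (n + 1)) • Vop n := funext fun n => by
    rw [smul_mul_assoc, (hT n).eq, mul_smul_comm]
  rw [e] at hl
  exact hl.unique hr

theorem rightModular_A {α : ℝ} (h0 : 0 < α) (h1 : α < 1) : RightModular (A α) := fun a =>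
  commute_A h0 h1 fun n => rightModular_leftRep (site n V) a

theorem commute_A_Vop {α : ℝ} (h0 : 0 < α) (h1 : α < 1) (j : ℕ) : Commute (A α) (Vop j) := by
  refine commute_A h0 h1 fun n => ?_
  rcases eq_or_ne n j with rfl | hn
  · exact Commute.refl _
  · rw [Commute, SemiconjBy, Vop_eq, Vop_eq, ← leftRep_mul, ← leftRep_mul, (commute_site hn V V).eq]

/-- The commutator of `A` with an operator of the `j`-th tensor factor only sees the `j`-th term
of the series defining `A`. -/
theorem A_mul_site {α : ℝ} (h0 : 0 < α) (h1 : α < 1) (j : ℕ) (x : Matrix (Fin 2) (Fin 2) ℂ) :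
    A α * leftRep (site j x) = leftRep (site j x) * A α +
      (α : ℂ) ^ (j + 1) • leftRep (site j (V * x - x * V)) := by
  set X := leftRep (site j x) with hX
  have hs := hasSum_A h0 h1
  have h := (hs.mul_right X).sub (hs.mul_left X)
  have hj := hasSum_single (f := fun n : ℕ =>
    ((α : ℂ) ^ (n + 1)) • Vop n * X - X * ((α : ℂ) ^ (n + 1)) • Vop n) j fun n hn => by
    rw [smul_mul_assoc, mul_smul_comm, ← smul_sub, hX, Vop_eq, ← leftRep_mul, ← leftRep_mul,
      (commute_site hn V x).eq, sub_self, smul_zero]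
  rw [← sub_eq_iff_eq_add', h.unique hj, smul_mul_assoc, mul_smul_comm, ← smul_sub, hX, Vop_eq,
    ← leftRep_mul, ← leftRep_mul, ← leftRep_sub, ← site_mul, ← site_mul, sub_eq_add_neg,
    sub_eq_add_neg, site_add, ← neg_one_smul ℂ (x * V), site_smul, neg_one_smul]

/-- `Aⁿ⁺² Vⱼ*` factors through `Aⁿ`, with a left factor that grows at most quadratically in `n`. -/
theorem exists_pow_A_mul_star {α : ℝ} (h0 : 0 < α) (h1 : α < 1) (j : ℕ) :
    ∃ S T U : L2 →L[ℂ] L2, ∀ n : ℕ,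
      A α ^ (n + 2) * leftRep (site j (star V)) =
        (S + (n + 2 : ℂ) • T - ((n + 2) * (n + 1) : ℂ) • U) * A α ^ n := by
  set c : ℂ := (α : ℂ) ^ (j + 1)
  set W := leftRep (site j (star V))
  set h : L2 →L[ℂ] L2 := c • leftRep (site j (V * star V - star V * V))
  set u : L2 →L[ℂ] L2 := (c * c) • Vop j
  have hV : V * (V * star V - star V * V) - (V * star V - star V * V) * V = (-2 : ℂ) • V := by
    rw [mul_sub, sub_mul, ← mul_assoc, ← mul_assoc, V_mul_star_V_mul_V, V_mul_V, zero_mul,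
      mul_assoc (star V), V_mul_V, mul_zero]
    module
  refine ⟨W * A α ^ 2, h * A α, u,
    pow_mul_of_commutators (A_mul_site h0 h1 j (star V)) ?_
      ((commute_A_Vop h0 h1 j).smul_right _).eq⟩
  have e := A_mul_site h0 h1 j (V * star V - star V * V)
  rw [hV, site_smul, leftRep_smul, ← Vop_eq] at e
  simp only [h, u, mul_smul_comm, smul_mul_assoc, e]
  module

/-! ### The local sets are subspaces -/

theorem tendsto_const_mul_sq_rpow {C : ℝ} (hC : 0 < C) :
    Tendsto (fun n : ℕ => (C * (n : ℝ) ^ 2) ^ (1 / (n : ℝ))) atTop (𝓝 1) := by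
  have h1 : Tendsto (fun n : ℕ => C ^ (1 / (n : ℝ))) atTop (𝓝 1) := by
    have h := (tendsto_const_nhds (x := C)).rpow tendsto_one_div_atTop_nhds_zero_nat
      (Or.inl hC.ne')
    rwa [Real.rpow_zero] at h
  have h2 : Tendsto (fun n : ℕ => (n : ℝ) ^ (1 / (n : ℝ))) atTop (𝓝 1) :=
    tendsto_rpow_div.comp tendsto_natCast_atTop_atTop
  have h3 := h1.mul (h2.pow 2)
  rw [one_pow, one_mul] at h3
  refine h3.congr fun n => ?_
  rw [Real.mul_rpow hC.le (by positivity), ← Real.rpow_natCast, ← Real.rpow_natCast,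
    ← Real.rpow_mul (by positivity), ← Real.rpow_mul (by positivity), mul_comm (1 / (n : ℝ))]

/-- Membership in the local set is insensitive to polynomial factors, because their `n`-th roots
tend to `1`. -/
theorem mem_localSet_of_eventually_le {γ : ℕ → ℝ} (hγ : ∀ n : ℕ, 1 ≤ n → 0 < γ n) {r : ℝ}
    {T : L2 →L[ℂ] L2} {ξ η ζ : L2} (hξ : ξ ∈ localSet γ r T)
    (hη : η ∈ localSet γ r T) {C : ℝ} (hC : 0 < C)
    (h : ∀ᶠ n : ℕ in atTop, ‖(T ^ n) ζ‖ ≤ C * (n : ℝ) ^ 2 * max ‖(T ^ n) ξ‖ ‖(T ^ n) η‖) :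
    ζ ∈ localSet γ r T := by
  have hlt : ∀ x ∈ localSet γ r T, ∀ s : ℝ, r < s →
      ∀ᶠ n : ℕ in atTop, γ n * ‖(T ^ n) x‖ ^ (1 / (n : ℝ)) < s := fun x hx s hs => by
    have hx' : limsup (fun n : ℕ => ((γ n * ‖(T ^ n) x‖ ^ (1 / (n : ℝ)) : ℝ) : EReal)) atTop
        ≤ (r : EReal) := hx
    filter_upwards [eventually_lt_of_limsup_lt (hx'.trans_lt (EReal.coe_lt_coe_iff.2 hs))]
      with n hn
    exact EReal.coe_lt_coe_iff.1 hn
  change limsup (fun n : ℕ => ((γ n * ‖(T ^ n) ζ‖ ^ (1 / (n : ℝ)) : ℝ) : EReal)) atTop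
    ≤ (r : EReal)
  refine le_of_forall_gt_imp_ge_of_dense fun b hb => ?_
  obtain ⟨s, hrs, hsb⟩ := EReal.lt_iff_exists_real_btwn.1 hb
  rw [EReal.coe_lt_coe_iff] at hrs
  refine le_trans (limsup_le_of_le (by isBoundedDefault) ?_) hsb.le
  have hmid : r < (r + s) / 2 := by linarith
  have htend := (tendsto_const_mul_sq_rpow hC).mul_const ((r + s) / 2)
  rw [one_mul] at htend
  filter_upwards [h, hlt ξ hξ _ hmid, hlt η hη _ hmid,
    htend.eventually_lt_const (show (r + s) / 2 < s by linarith), eventually_ge_atTop 1]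
    with n hn h1 h2 h3 hn1
  rw [EReal.coe_le_coe_iff]
  have hγn := hγ n hn1
  have hexp : (0 : ℝ) ≤ 1 / (n : ℝ) := by positivity
  have hmax : γ n * max ‖(T ^ n) ξ‖ ‖(T ^ n) η‖ ^ (1 / (n : ℝ)) ≤ (r + s) / 2 := by
    rcases max_choice ‖(T ^ n) ξ‖ ‖(T ^ n) η‖ with e | e <;> rw [e]
    exacts [h1.le, h2.le]
  calc γ n * ‖(T ^ n) ζ‖ ^ (1 / (n : ℝ))
      ≤ γ n * (C * (n : ℝ) ^ 2 * max ‖(T ^ n) ξ‖ ‖(T ^ n) η‖) ^ (1 / (n : ℝ)) := by gcongr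
    _ = (C * (n : ℝ) ^ 2) ^ (1 / (n : ℝ)) *
        (γ n * max ‖(T ^ n) ξ‖ ‖(T ^ n) η‖ ^ (1 / (n : ℝ))) := by
      rw [Real.mul_rpow (by positivity) (by positivity)]
      ring
    _ ≤ (C * (n : ℝ) ^ 2) ^ (1 / (n : ℝ)) * ((r + s) / 2) := by gcongr
    _ ≤ s := h3.le

theorem mem_localSet_of_norm_le {γ : ℕ → ℝ} (hγ : ∀ n : ℕ, 1 ≤ n → 0 < γ n) {r : ℝ}
    {T : L2 →L[ℂ] L2} {ξ ζ : L2} (hξ : ξ ∈ localSet γ r T) {C : ℝ} (hC : 0 ≤ C)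
    (h : ∀ᶠ n : ℕ in atTop, ‖(T ^ n) ζ‖ ≤ C * (n : ℝ) ^ 2 * ‖(T ^ n) ξ‖) :
    ζ ∈ localSet γ r T := by
  refine mem_localSet_of_eventually_le hγ hξ hξ (C := C + 1) (by linarith) ?_
  filter_upwards [h] with n hn
  rw [max_self]
  refine hn.trans ?_
  gcongr
  linarith

theorem zero_mem_localSet (γ : ℕ → ℝ) {r : ℝ} (hr : 0 < r) (T : L2 →L[ℂ] L2) :
    (0 : L2) ∈ localSet γ r T := by
  change limsup (fun n : ℕ => ((γ n * ‖(T ^ n) 0‖ ^ (1 / (n : ℝ)) : ℝ) : EReal)) atTop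
    ≤ (r : EReal)
  refine limsup_le_of_le (by isBoundedDefault) ?_
  filter_upwards [eventually_ge_atTop 1] with n hn
  rw [EReal.coe_le_coe_iff, map_zero, norm_zero, Real.zero_rpow (by positivity), mul_zero]
  exact hr.le

theorem mem_localSet_of_pow_apply_eq_zero {γ : ℕ → ℝ} (hγ : ∀ n : ℕ, 1 ≤ n → 0 < γ n) {r : ℝ}
    (hr : 0 < r) {T : L2 →L[ℂ] L2} {ξ : L2} {m : ℕ} (h : (T ^ m) ξ = 0) : ξ ∈ localSet γ r T := by
  refine mem_localSet_of_norm_le hγ (zero_mem_localSet γ hr T) zero_le_one ?_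
  filter_upwards [eventually_ge_atTop m] with n hn
  obtain ⟨k, rfl⟩ := Nat.exists_eq_add_of_le' hn
  rw [pow_add, clm_mul_apply, h, map_zero, map_zero, norm_zero, mul_zero]

/-- The set `ℰᵣ(T)` as a subspace. -/
def localSubmodule {γ : ℕ → ℝ} (hγ : ∀ n : ℕ, 1 ≤ n → 0 < γ n) {r : ℝ} (hr : 0 < r)
    (T : L2 →L[ℂ] L2) : Submodule ℂ L2 where
  carrier := localSet γ r T
  zero_mem' := zero_mem_localSet γ hr T
  add_mem' {ξ η} hξ hη := by
    refine mem_localSet_of_eventually_le hγ hξ hη two_pos ?_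
    filter_upwards [eventually_ge_atTop 1] with n hn
    have h1 : (1 : ℝ) ≤ (n : ℝ) ^ 2 := one_le_pow₀ (by exact_mod_cast hn)
    have h2 : 0 ≤ max ‖(T ^ n) ξ‖ ‖(T ^ n) η‖ := le_max_of_le_left (norm_nonneg _)
    calc ‖(T ^ n) (ξ + η)‖ ≤ ‖(T ^ n) ξ‖ + ‖(T ^ n) η‖ := by
          rw [map_add]
          exact norm_add_le _ _
      _ ≤ 2 * 1 * max ‖(T ^ n) ξ‖ ‖(T ^ n) η‖ := by
        linarith [le_max_left ‖(T ^ n) ξ‖ ‖(T ^ n) η‖, le_max_right ‖(T ^ n) ξ‖ ‖(T ^ n) η‖]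
      _ ≤ _ := by gcongr
  smul_mem' c ξ hξ := by
    refine mem_localSet_of_norm_le hγ hξ (norm_nonneg c) ?_
    filter_upwards [eventually_ge_atTop 1] with n hn
    have h1 : (1 : ℝ) ≤ (n : ℝ) ^ 2 := one_le_pow₀ (by exact_mod_cast hn)
    rw [map_smul, norm_smul]
    gcongr
    exact le_mul_of_one_le_right (norm_nonneg c) h1

/-- Operators commuting with `T` leave `ℰᵣ(T)` invariant. -/
theorem apply_mem_localSet_of_commute {γ : ℕ → ℝ} (hγ : ∀ n : ℕ, 1 ≤ n → 0 < γ n) {r : ℝ}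
    {S T : L2 →L[ℂ] L2} (hST : Commute T S) {ξ : L2} (hξ : ξ ∈ localSet γ r T) :
    S ξ ∈ localSet γ r T := by
  refine mem_localSet_of_norm_le hγ hξ (norm_nonneg S) ?_
  filter_upwards [eventually_ge_atTop 1] with n hn
  have h1 : (1 : ℝ) ≤ (n : ℝ) ^ 2 := one_le_pow₀ (by exact_mod_cast hn)
  rw [← clm_mul_apply, (hST.pow_left n).eq, clm_mul_apply]
  refine (S.le_opNorm _).trans ?_
  gcongr
  exact le_mul_of_one_le_right (norm_nonneg S) h1

/-- `Vⱼ* A²` leaves `ℰᵣ(A)` invariant. -/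
theorem star_site_pow_two_mem_localSet {γ : ℕ → ℝ} (hγ : ∀ n : ℕ, 1 ≤ n → 0 < γ n) {r : ℝ}
    {α : ℝ} (h0 : 0 < α) (h1 : α < 1) (j : ℕ) {ξ : L2}
    (hξ : ξ ∈ localSet γ r (A α)) :
    leftRep (site j (star V)) (A α (A α ξ)) ∈ localSet γ r (A α) := by
  obtain ⟨S, T, U, h⟩ := exists_pow_A_mul_star h0 h1 j
  refine mem_localSet_of_norm_le hγ hξ (C := ‖S‖ + ‖T‖ + ‖U‖) (by positivity) ?_
  filter_upwards [eventually_ge_atTop 2] with n hn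
  obtain ⟨k, rfl⟩ := Nat.exists_eq_add_of_le' hn
  have e : (A α ^ (k + 2)) (leftRep (site j (star V)) (A α (A α ξ))) =
      (S + (k + 2 : ℂ) • T - ((k + 2) * (k + 1) : ℂ) • U) ((A α ^ (k + 2)) ξ) := by
    rw [← clm_mul_apply, h k, pow_add (A α) k 2, pow_two]
    rfl
  have hk : (1 : ℝ) ≤ ((k + 2 : ℕ) : ℝ) := by
    push_cast
    linarith [Nat.cast_nonneg (α := ℝ) k]
  have n1 : ‖(k + 2 : ℂ)‖ = ((k + 2 : ℕ) : ℝ) := by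
    rw [← Complex.norm_natCast]
    push_cast
    rfl
  have n2 : ‖((k + 2) * (k + 1) : ℂ)‖ = ((k + 2 : ℕ) : ℝ) * ((k + 1 : ℕ) : ℝ) := by
    rw [norm_mul, n1, ← Complex.norm_natCast (k + 1)]
    push_cast
    rfl
  have hbound : ‖S + (k + 2 : ℂ) • T - ((k + 2) * (k + 1) : ℂ) • U‖ ≤
      (‖S‖ + ‖T‖ + ‖U‖) * ((k + 2 : ℕ) : ℝ) ^ 2 := by
    calc _ ≤ ‖S‖ + ‖(k + 2 : ℂ) • T‖ + ‖((k + 2) * (k + 1) : ℂ) • U‖ :=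
          (norm_sub_le _ _).trans (add_le_add_left (norm_add_le _ _) _)
      _ = ‖S‖ * 1 + ‖T‖ * ((k + 2 : ℕ) : ℝ) +
          ‖U‖ * (((k + 2 : ℕ) : ℝ) * ((k + 1 : ℕ) : ℝ)) := by
        rw [norm_smul, norm_smul, n1, n2]
        ring
      _ ≤ ‖S‖ * ((k + 2 : ℕ) : ℝ) ^ 2 + ‖T‖ * ((k + 2 : ℕ) : ℝ) ^ 2 +
          ‖U‖ * ((k + 2 : ℕ) : ℝ) ^ 2 := by
        gcongr
        · exact one_le_pow₀ hk
        · exact le_self_pow₀ hk two_ne_zero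
        · rw [pow_two]
          gcongr
          exact Nat.le_succ _
      _ = _ := by ring
  rw [e]
  exact (le_opNorm _ _).trans (by gcongr)

/-! ### The dichotomy -/

/-- If a bounded operator maps a subspace into itself, it does so with the closure. -/
theorem apply_mem_topologicalClosure {K L : Submodule ℂ L2} (T : L2 →L[ℂ] L2)
    (h : ∀ ξ ∈ K, T ξ ∈ L.topologicalClosure) {ξ : L2} (hξ : ξ ∈ K.topologicalClosure) :
    T ξ ∈ L.topologicalClosure :=
  K.topologicalClosure_minimal (t := L.topologicalClosure.comap (T : L2 →ₗ[ℂ] L2)) h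
    (L.isClosed_topologicalClosure.preimage T.continuous) hξ

/-- The union of the kernels of the powers of an operator. -/
def kerUnion (T : L2 →L[ℂ] L2) : Submodule ℂ L2 where
  carrier := {ξ | ∃ n : ℕ, (T ^ n) ξ = 0}
  zero_mem' := ⟨0, map_zero _⟩
  add_mem' := by
    rintro ξ η ⟨m, hm⟩ ⟨n, hn⟩
    refine ⟨m + n, ?_⟩
    rw [map_add, add_comm m n, pow_add, clm_mul_apply, hm, map_zero, zero_add, ← pow_add,
      add_comm n m, pow_add, clm_mul_apply, hn, map_zero]
  smul_mem' := by
    rintro c ξ ⟨n, hn⟩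
    exact ⟨n, by rw [map_smul, hn, smul_zero]⟩

theorem apply_mem_kerUnion_of_commute {S T : L2 →L[ℂ] L2} (hST : Commute T S) {ξ : L2}
    (hξ : ξ ∈ kerUnion T) : S ξ ∈ kerUnion T := by
  obtain ⟨n, hn⟩ := hξ
  exact ⟨n, by rw [← clm_mul_apply, (hST.pow_left n).eq, clm_mul_apply, hn, map_zero]⟩

/-- If `A` is not injective, then the kernels of its powers span a dense subspace. -/
theorem topologicalClosure_kerUnion_eq_top {α : ℝ} (h0 : 0 < α) (h1 : α < 1) {ξ : L2}
    (hξ : A α ξ = 0) (hne : ξ ≠ 0) : (kerUnion (A α)).topologicalClosure = ⊤ := by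
  set N := kerUnion (A α)
  have hle := N.le_topologicalClosure
  refine (eq_bot_or_eq_top_of_invariant N.topologicalClosure N.isClosed_topologicalClosure
    (fun a η hη => apply_mem_topologicalClosure _ (fun ζ hζ => hle ?_) hη)
    (fun j η hη => apply_mem_topologicalClosure _ (fun ζ hζ => hle ?_) hη)
    (fun j η hη => apply_mem_topologicalClosure _ (fun ζ hζ => hle ?_) hη)).resolve_left ?_
  · exact apply_mem_kerUnion_of_commute (rightModular_A h0 h1 a) hζ
  · exact apply_mem_kerUnion_of_commute (commute_A_Vop h0 h1 j) hζ
  · obtain ⟨n, hn⟩ := hζ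
    obtain ⟨S, T, U, h⟩ := exists_pow_A_mul_star h0 h1 j
    exact ⟨n + 2, by rw [← clm_mul_apply, h, clm_mul_apply, hn, map_zero]⟩
  · intro hbot
    have hmem : ξ ∈ N.topologicalClosure := hle ⟨1, by rwa [pow_one]⟩
    rw [hbot, Submodule.mem_bot] at hmem
    exact hne hmem

theorem topologicalClosure_localSubmodule_eq_bot_or_eq_top {γ : ℕ → ℝ}
    (hγ : ∀ n : ℕ, 1 ≤ n → 0 < γ n) {r : ℝ} (hr : 0 < r) {α : ℝ} (h0 : 0 < α) (h1 : α < 1) :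
    (localSubmodule hγ hr (A α)).topologicalClosure = ⊥ ∨
      (localSubmodule hγ hr (A α)).topologicalClosure = ⊤ := by
  set E := localSubmodule hγ hr (A α)
  set H := E.topologicalClosure with hH
  have hle : E ≤ H := E.le_topologicalClosure
  have hclosed : IsClosed (H : Set L2) := E.isClosed_topologicalClosure
  have hcomm : ∀ S, Commute (A α) S → ∀ ξ ∈ H, S ξ ∈ H := fun S hS ξ hξ =>
    apply_mem_topologicalClosure S
      (fun η hη => hle (apply_mem_localSet_of_commute hγ hS hη)) hξ
  have hR : ∀ a, ∀ ξ ∈ H, rightRep a ξ ∈ H := fun a => hcomm _ (rightModular_A h0 h1 a)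
  by_cases hinj : ∀ ξ, A α ξ = 0 → ξ = 0
  · refine eq_bot_or_eq_top_of_invariant H hclosed hR
      (fun j => hcomm _ (commute_A_Vop h0 h1 j)) fun j => ?_
    have : CompleteSpace H := hclosed.completeSpace_coe
    have hdense := (rightModular_A h0 h1).le_closure_map hinj H hR
      (hcomm _ (Commute.refl _))
    -- as `A H` is dense in `H`, invariance under `S A` implies invariance under `S`
    have hcancel : ∀ S : L2 →L[ℂ] L2, (∀ ξ ∈ H, S (A α ξ) ∈ H) → ∀ ξ ∈ H, S ξ ∈ H := by
      intro S hS ξ hξ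
      refine apply_mem_topologicalClosure S (fun η hη => ?_) (hdense hξ)
      obtain ⟨ζ, hζ, rfl⟩ := hη
      exact hS ζ hζ
    exact hcancel _ (hcancel (leftRep (site j (star V)) * A α) fun ξ hξ =>
      apply_mem_topologicalClosure (leftRep (site j (star V)) * A α * A α)
        (fun η hη => hle (star_site_pow_two_mem_localSet hγ h0 h1 j hη)) hξ)
  · right
    push Not at hinj
    obtain ⟨ξ, hξ, hne⟩ := hinj
    rw [eq_top_iff, ← topologicalClosure_kerUnion_eq_top h0 h1 hξ hne]
    refine Submodule.topologicalClosure_mono ?_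
    rintro η ⟨n, hn⟩
    exact mem_localSet_of_pow_apply_eq_zero hγ hr hn

end HyperfiniteFactor
end

theorem mainTheorem3 (α : ℝ) (hα0 : 0 < α) (hα1 : α < 1) (r : ℝ) (hr : 0 < r)
    (γ : ℕ → ℝ) (hγ : ∀ n : ℕ, 1 ≤ n → 0 < γ n) :
    HyperfiniteFactor.localSubspace γ r (HyperfiniteFactor.A α) = Set.univ ∨
      HyperfiniteFactor.localSubspace γ r (HyperfiniteFactor.A α) = {0} := by
  have e : HyperfiniteFactor.localSubspace γ r (HyperfiniteFactor.A α) =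
      ((HyperfiniteFactor.localSubmodule hγ hr (HyperfiniteFactor.A α)).topologicalClosure :
        Set HyperfiniteFactor.L2) := rfl
  rw [e]
  rcases HyperfiniteFactor.topologicalClosure_localSubmodule_eq_bot_or_eq_top hγ hr hα0 hα1 with
    h | h
  · exact Or.inr (by rw [h, Submodule.bot_coe])
  · exact Or.inl (by rw [h, Submodule.top_coe])
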